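/- All rings are commutative Noetherian with identity. Complexes $C=(\cdots\to C_{i+1}\to C_i\to C_{i-1}\to\cdots)$ are graded homologically by $\mathbb Z$, and $\sup C=\sup\{i: C_i\neq 0\}$, $\inf C=\inf\{i: C_i\ne 0\}$, $\operatorname{hsup}C=\sup\{i: \operatorname{H}_i(C)\neq 0\}$, $\operatorname{hinf}C=\inf\{i: \operatorname{H}_i(C)\neq 0\}$; $C$ is bounded below if $\inf C>-\infty$, bounded above if $\sup C<\infty$, and bounded if both hold. Let $M$ be a module over a ring $S$. A quasi-projective resolution of $M$ over $S$ is a bounded below complex $P$ of projective $S$-modules for which there are non-negative integers $a_i$ ($i\ge\inf P$), not all zero, with $\operatorname{H}_i(P)\cong M^{\oplus a_i}$ for all $i\geq\inf P$. A quasi-injective resolution of $M$ over $S$ is a bounded above complex $I$ of injective $S$-modules for which there are non-negative integers $b_i$ ($i\le\sup I$), not all zero, with $\operatorname{H}_i(I)\cong M^{\oplus b_i}$ for all $i\leq\sup I$. For $M\neq 0$ put $$\operatorname{qpd}_S M=\inf\{\sup P-\operatorname{hsup}P : P \text{ a bounded quasi-projective resolution of } M\text{ over }S\},$$ $$\operatorname{qid}_S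 M=\inf\{\operatorname{hinf}I-\inf I : I \text{ a bounded quasi-injective resolution of } M\text{ over }S\},$$ where the infimum of the empty set is $\infty$; for $M=0$ both are $-\infty$. **Proposition.** Let $Q$ be a ring, $f\in Q$ a nonzero-divisor, $R=Q/(f)$, and $M$ an $R$-module, regarded also as a $Q$-module and, for each $n\geq 1$, as a $Q/(f^n)$-module through the surjections $Q\to Q/(f^n)\to R$. 1. If $\operatorname{qpd}_Q M<\infty$, then $\operatorname{qpd}_{Q/(f^n)}M<\infty$ for all $n\gg 0$ (that is, there is an $N$ such that this holds for all $n\geq 1$ with $n\geq N$). Conversely, if $\operatorname{qpd}_R M<\infty$, then $\operatorname{qpd}_Q M<\infty$. 2. If $\operatorname{qid}_Q M<\infty$, then $\operatorname{qid}_{Q/(f^n)}M<\infty$ for all $n\gg 0$. Conversely, if $\operatorname{qid}_R M<\infty$, then $\operatorname{qid}_Q M<\infty$. -/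

import Mathlib

open CategoryTheory CategoryTheory.Limits

universe u v w

namespace QuasiDim

noncomputable section

variable {A : Type u} [Category.{v} A] [Abelian A]

attribute [local instance] Abelian.hasFiniteBiproducts

/-- The supremum of `{i | C_i ≠ 0}`, in the extended reals (so it is `-∞` for the zero complex).
Complexes are graded homologically by `ℤ`: the differential goes from degree `i` to `i - 1`. -/
def sup (C : ChainComplex A ℤ) : EReal :=
  sSup {x : EReal | ∃ i : ℤ, ¬ IsZero (C.X i) ∧ x = ((i : ℝ) : EReal)}

/-- The infimum of `{i | C_i ≠ 0}` (it is `+∞` for the zero complex). -/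
def inf (C : ChainComplex A ℤ) : EReal :=
  sInf {x : EReal | ∃ i : ℤ, ¬ IsZero (C.X i) ∧ x = ((i : ℝ) : EReal)}

/-- The supremum of `{i | H_i(C) ≠ 0}`. -/
def hsup (C : ChainComplex A ℤ) : EReal :=
  sSup {x : EReal | ∃ i : ℤ, ¬ IsZero (C.homology i) ∧ x = ((i : ℝ) : EReal)}

/-- The infimum of `{i | H_i(C) ≠ 0}`. -/
def hinf (C : ChainComplex A ℤ) : EReal :=
  sInf {x : EReal | ∃ i : ℤ, ¬ IsZero (C.homology i) ∧ x = ((i : ℝ) : EReal)}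

/-- `C` is bounded below, i.e. `inf C > -∞`. -/
def IsBddBelow (C : ChainComplex A ℤ) : Prop := BddBelow {i : ℤ | ¬ IsZero (C.X i)}

/-- `C` is bounded above, i.e. `sup C < ∞`. -/
def IsBddAbove (C : ChainComplex A ℤ) : Prop := BddAbove {i : ℤ | ¬ IsZero (C.X i)}

/-- `C` is bounded, i.e. `sup C - inf C < ∞`. -/
def IsBdd (C : ChainComplex A ℤ) : Prop := IsBddBelow C ∧ IsBddAbove C

/-- `P` is a quasi-projective resolution of `M`: a bounded below complex of projective objects
for which there are non-negative integers `a_i` (`i ≥ inf P`), not all zero, such that `H_i(P)` is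
isomorphic to the direct sum of `a_i` copies of `M` for all `i ≥ inf P`. -/
structure IsQuasiProjectiveResolution (P : ChainComplex A ℤ) (M : A) : Prop where
  bddBelow : IsBddBelow P
  projective : ∀ i : ℤ, Projective (P.X i)
  homology : ∃ a : ℤ → ℕ,
    (∃ i : ℤ, inf P ≤ ((i : ℝ) : EReal) ∧ a i ≠ 0) ∧
    ∀ i : ℤ, inf P ≤ ((i : ℝ) : EReal) → Nonempty (P.homology i ≅ ⨁ fun _ : Fin (a i) => M)

/-- `I` is a quasi-injective resolution of `M`: a bounded above complex of injective objects
for which there are non-negative integers `b_i` (`i ≤ sup I`), not all zero, such that `H_i(I)` is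
isomorphic to the direct sum of `b_i` copies of `M` for all `i ≤ sup I`. -/
structure IsQuasiInjectiveResolution (I : ChainComplex A ℤ) (M : A) : Prop where
  bddAbove : IsBddAbove I
  injective : ∀ i : ℤ, Injective (I.X i)
  homology : ∃ b : ℤ → ℕ,
    (∃ i : ℤ, ((i : ℝ) : EReal) ≤ sup I ∧ b i ≠ 0) ∧
    ∀ i : ℤ, ((i : ℝ) : EReal) ≤ sup I → Nonempty (I.homology i ≅ ⨁ fun _ : Fin (b i) => M)

open Classical in
/-- The quasi-projective dimension of `M`: the infimum of `sup P - hsup P` over all bounded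
quasi-projective resolutions `P` of `M` (so `∞` if there are none), and `-∞` if `M = 0`. -/
def qpd (M : A) : EReal :=
  if IsZero M then ⊥
  else sInf {x : EReal | ∃ P : ChainComplex A ℤ,
    IsQuasiProjectiveResolution P M ∧ IsBdd P ∧ x = sup P - hsup P}

open Classical in
/-- The quasi-injective dimension of `M`: the infimum of `hinf I - inf I` over all bounded
quasi-injective resolutions `I` of `M` (so `∞` if there are none), and `-∞` if `M = 0`. -/
def qid (M : A) : EReal :=
  if IsZero M then ⊥
  else sInf {x : EReal | ∃ I : ChainComplex A ℤ,
    IsQuasiInjectiveResolution I M ∧ IsBdd I ∧ x = hinf I - inf I}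

/-- A `Q/(f)`-module regarded as a `Q`-module through `Q → Q/(f)`. -/
abbrev toBase {Q : Type u} [CommRing Q] (f : Q)
    (M : ModuleCat.{w} (Q ⧸ Ideal.span {f})) : ModuleCat.{w} Q :=
  (ModuleCat.restrictScalars (Ideal.Quotient.mk (Ideal.span {f}))).obj M

theorem span_pow_le {Q : Type u} [CommRing Q] (f : Q) (n : ℕ) (hn : n ≠ 0) :
    Ideal.span {f ^ n} ≤ Ideal.span {f} :=
  (Ideal.span_singleton_le_span_singleton).2 (dvd_pow_self f hn)

/-- A `Q/(f)`-module regarded as a `Q/(f^n)`-module (`n ≥ 1`) through the canonical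
surjection `Q/(f^n) → Q/(f)`. -/
abbrev toPow {Q : Type u} [CommRing Q] (f : Q) (n : ℕ) (hn : n ≠ 0)
    (M : ModuleCat.{w} (Q ⧸ Ideal.span {f})) : ModuleCat.{w} (Q ⧸ Ideal.span {f ^ n}) :=
  (ModuleCat.restrictScalars (Ideal.Quotient.factor (span_pow_le f n hn))).obj M

end

end QuasiDim

/-! Finiteness of either dimension, for `M ≠ 0`, only asks for a bounded complex of projectives
(injectives) that is not acyclic and whose homology modules are all finite powers of `M`.

From `Q` to `Q/(f^n)`: let `P` be such a complex of projectives over `Q`. Since `f` kills `M`, it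
kills the homology of `P`. By boundedness and projectivity, some power of `f`, hence every higher
power, is null-homotopic on `P`. As `f^n` is regular on projectives, `0 → P → P → P/f^nP → 0` is
exact, with first map `f^n`. A null-homotopy of that map splits the long exact sequence, so
`H_i(P/f^nP) ≅ H_i(P) ⊕ H_{i-1}(P)`, first over `Q` and then over `Q/(f^n)` because restriction is
fully faithful. Thus `P/f^nP` is the required complex. For injectives, multiplication by `f^n` is
surjective and its kernel, the `f^n`-torsion subcomplex, plays the dual role.

From `R` to `Q`: projective `R`-modules have projective dimension at most one over `Q`. A bounded
complex `C` of such modules is covered by a contractible complex of projectives; the kernel is again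
a bounded complex of projectives and has the homology of `C` shifted by one. Injectives are dual. -/

namespace QuasiDim

noncomputable section

attribute [local instance] Abelian.hasFiniteBiproducts

/-! ### Finite direct powers of an object. -/

section Abelian

variable {A : Type u} [Category.{v} A] [Abelian A]

/-- `X` is a finite direct sum of copies of `M`. -/
def IsFinitePower (M X : A) : Prop := ∃ n : ℕ, Nonempty (X ≅ ⨁ fun _ : Fin n => M)

namespace IsFinitePower

variable {M X Y : A}

theorem of_iso (h : IsFinitePower M X) (e : X ≅ Y) : IsFinitePower M Y := by
  obtain ⟨n, ⟨i⟩⟩ := h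
  exact ⟨n, ⟨e.symm ≪≫ i⟩⟩

theorem of_iso_base {N : A} (h : IsFinitePower M X) (e : M ≅ N) : IsFinitePower N X := by
  obtain ⟨n, ⟨i⟩⟩ := h
  exact ⟨n, ⟨i ≪≫ biproduct.mapIso fun _ => e⟩⟩

theorem of_isZero (h : IsZero X) : IsFinitePower M X :=
  ⟨0, ⟨h.iso ((IsZero.iff_id_eq_zero _).2 (biproduct.hom_ext _ _ fun i => i.elim0))⟩⟩

theorem of_fintype {J : Type} [Fintype J] (h : Nonempty (X ≅ ⨁ fun _ : J => M)) :
    IsFinitePower M X := by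
  obtain ⟨e⟩ := h
  exact ⟨Fintype.card J,
    ⟨e ≪≫ biproduct.whiskerEquiv (Fintype.equivFin J) fun _ => Iso.refl M⟩⟩

/-- Indexing by `Fin m ⊕ Fin n` makes the power a bilimit bicone on `X` and `Y`; its totality
relation is that of the big biproduct, with the sum cut in two. -/
theorem biprod (hX : IsFinitePower M X) (hY : IsFinitePower M Y) : IsFinitePower M (X ⊞ Y) := by
  obtain ⟨m, ⟨e⟩⟩ := hX
  obtain ⟨n, ⟨e'⟩⟩ := hY
  let b : BinaryBicone X Y :=
    { pt := ⨁ fun _ : Fin m ⊕ Fin n => M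
      fst := biproduct.lift (fun i => biproduct.π _ (Sum.inl i)) ≫ e.inv
      snd := biproduct.lift (fun i => biproduct.π _ (Sum.inr i)) ≫ e'.inv
      inl := e.hom ≫ biproduct.desc (fun i => biproduct.ι (fun _ : Fin m ⊕ Fin n => M) (Sum.inl i))
      inr := e'.hom ≫
        biproduct.desc (fun i => biproduct.ι (fun _ : Fin m ⊕ Fin n => M) (Sum.inr i))
      inl_fst := by
        rw [Category.assoc, ← Iso.eq_inv_comp, ← Category.assoc, Iso.comp_inv_eq]
        ext i j
        simp [biproduct.ι_π]
      inl_snd := by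
        rw [Category.assoc, ← Iso.eq_inv_comp, ← Category.assoc, Iso.comp_inv_eq]
        ext i j
        simp
      inr_fst := by
        rw [Category.assoc, ← Iso.eq_inv_comp, ← Category.assoc, Iso.comp_inv_eq]
        ext i j
        simp
      inr_snd := by
        rw [Category.assoc, ← Iso.eq_inv_comp, ← Category.assoc, Iso.comp_inv_eq]
        ext i j
        simp [biproduct.ι_π] }
  have hb : b.IsBilimit := isBinaryBilimitOfTotal b (by
    have := biproduct.total (f := fun _ : Fin m ⊕ Fin n => M)
    rw [Fintype.sum_sum_type] at this
    dsimp only [b]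
    simp only [Category.assoc, Iso.inv_hom_id_assoc, biproduct.lift_desc]
    exact this)
  exact of_fintype ⟨biprod.uniqueUpToIso X Y hb |>.symm⟩

theorem map {B : Type*} [Category* B] [Abelian B] (F : A ⥤ B) [F.Additive]
    (h : IsFinitePower M X) : IsFinitePower (F.obj M) (F.obj X) := by
  obtain ⟨n, ⟨e⟩⟩ := h
  exact ⟨n, ⟨F.mapIso e ≪≫ F.mapBiproduct _⟩⟩

theorem of_map {B : Type*} [Category* B] [Abelian B] (F : A ⥤ B) [F.Additive] [F.Full]
    [F.Faithful] (h : IsFinitePower (F.obj M) (F.obj X)) : IsFinitePower M X := by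
  obtain ⟨n, ⟨e⟩⟩ := h
  exact ⟨n, ⟨F.preimageIso (e ≪≫ (F.mapBiproduct fun _ : Fin n => M).symm)⟩⟩

theorem smul_id_eq_zero {R : Type*} [Ring R] [Linear R A] {r : R} (h : IsFinitePower M X)
    (hr : r • 𝟙 M = 0) : r • 𝟙 X = 0 := by
  obtain ⟨n, ⟨e⟩⟩ := h
  have h0 : r • 𝟙 (⨁ fun _ : Fin n => M) = 0 := by
    refine biproduct.hom_ext _ _ fun i => ?_
    rw [Linear.smul_comp, Category.id_comp, zero_comp, ← Category.comp_id (biproduct.π _ i),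
      ← Linear.comp_smul, hr, comp_zero]
  rw [← e.hom_inv_id, ← Category.id_comp e.inv, ← Linear.comp_smul, ← Linear.smul_comp, h0,
    zero_comp, comp_zero]

end IsFinitePower

theorem not_isZero_of_iso_power {M X : A} (hM : ¬ IsZero M) {n : ℕ} (hn : n ≠ 0)
    (e : X ≅ ⨁ fun _ : Fin n => M) : ¬ IsZero X := by
  intro h
  refine hM ?_
  let i : Fin n := ⟨0, Nat.pos_of_ne_zero hn⟩
  rw [IsZero.iff_id_eq_zero, ← biproduct.ι_π_self (fun _ : Fin n => M) i,
    (IsZero.of_iso h e.symm).eq_of_src (biproduct.π _ i) 0, comp_zero]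

/-! ### Finiteness of the quasi-dimensions as existence of a complex. -/

theorem isZero_X_of_not_inf_le {C : ChainComplex A ℤ} {i : ℤ}
    (h : ¬ inf C ≤ ((i : ℝ) : EReal)) : IsZero (C.X i) := by
  by_contra hi
  exact h (sInf_le ⟨i, hi, rfl⟩)

theorem isZero_X_of_not_le_sup {C : ChainComplex A ℤ} {i : ℤ}
    (h : ¬ ((i : ℝ) : EReal) ≤ sup C) : IsZero (C.X i) := by
  by_contra hi
  exact h (le_sSup ⟨i, hi, rfl⟩)

theorem isZero_homology_of_isZero_X {ι : Type*} {c : ComplexShape ι}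
    {C : HomologicalComplex A c} {i : ι}
    (h : IsZero (C.X i)) : IsZero (C.homology i) :=
  (C.exactAt_iff_isZero_homology i).1 (ShortComplex.exact_of_isZero_X₂ _ h)

theorem sup_lt_top {C : ChainComplex A ℤ} (h : IsBddAbove C) : sup C < ⊤ := by
  obtain ⟨b, hb⟩ := h
  refine lt_of_le_of_lt (b := ((b : ℝ) : EReal)) (sSup_le ?_) (EReal.coe_lt_top _)
  rintro _ ⟨i, hi, rfl⟩
  exact EReal.coe_le_coe_iff.2 (Int.cast_le.2 (hb hi))

theorem bot_lt_inf {C : ChainComplex A ℤ} (h : IsBddBelow C) : ⊥ < inf C := by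
  obtain ⟨b, hb⟩ := h
  refine lt_of_lt_of_le (EReal.bot_lt_coe (b : ℝ)) (le_sInf ?_)
  rintro _ ⟨i, hi, rfl⟩
  exact EReal.coe_le_coe_iff.2 (Int.cast_le.2 (hb hi))

theorem EReal_sub_lt_top {x y : EReal} (hx : x < ⊤) (hy : ⊥ < y) : x - y < ⊤ := by
  rw [sub_eq_add_neg]
  exact EReal.add_lt_top hx.ne (by simpa using hy.ne')

theorem qpd_lt_top_of_isZero {M : A} (h : IsZero M) : qpd M < ⊤ := by
  simp [qpd, h]

theorem qid_lt_top_of_isZero {M : A} (h : IsZero M) : qid M < ⊤ := by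
  simp [qid, h]

/-- Below `inf P` the homology vanishes, so it is the zeroth power of `M` and the range restriction
disappears. As `M ≠ 0`, a nonzero exponent means nonzero homology, which keeps `hsup P` above `⊥`
and so makes `sup P - hsup P` less than `⊤`. -/
theorem qpd_lt_top_iff {M : A} (hM : ¬ IsZero M) :
    qpd M < ⊤ ↔ ∃ P : ChainComplex A ℤ, IsBdd P ∧ (∀ i, Projective (P.X i)) ∧
      (∀ i, IsFinitePower M (P.homology i)) ∧ ∃ i, ¬ IsZero (P.homology i) := by
  rw [qpd, if_neg hM, sInf_lt_iff]
  constructor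
  · rintro ⟨_, ⟨P, ⟨-, hproj, a, ⟨i, hi, hai⟩, ha⟩, hb, -⟩, -⟩
    refine ⟨P, hb, hproj, fun j => ?_, i, not_isZero_of_iso_power hM hai (ha i hi).some⟩
    by_cases hj : inf P ≤ ((j : ℝ) : EReal)
    · exact ⟨a j, ha j hj⟩
    · exact .of_isZero (isZero_homology_of_isZero_X (isZero_X_of_not_inf_le hj))
  · rintro ⟨P, hb, hproj, hpow, i, hi⟩
    choose a ha using hpow
    refine ⟨_, ⟨P, ⟨hb.1, hproj, a, ⟨i, ?_, ?_⟩, fun j _ => ha j⟩, hb, rfl⟩, ?_⟩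
    · by_contra h
      exact hi (isZero_homology_of_isZero_X (isZero_X_of_not_inf_le h))
    · intro h0
      have := ha i
      rw [h0] at this
      exact hi (.of_iso ((IsZero.iff_id_eq_zero _).2
        (biproduct.hom_ext _ _ fun i => i.elim0)) this.some)
    · exact EReal_sub_lt_top (sup_lt_top hb.2)
        (lt_of_lt_of_le (EReal.bot_lt_coe (i : ℝ)) (le_sSup ⟨i, hi, rfl⟩))

theorem qid_lt_top_iff {M : A} (hM : ¬ IsZero M) :
    qid M < ⊤ ↔ ∃ I : ChainComplex A ℤ, IsBdd I ∧ (∀ i, Injective (I.X i)) ∧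
      (∀ i, IsFinitePower M (I.homology i)) ∧ ∃ i, ¬ IsZero (I.homology i) := by
  rw [qid, if_neg hM, sInf_lt_iff]
  constructor
  · rintro ⟨_, ⟨P, ⟨-, hinj, a, ⟨i, hi, hai⟩, ha⟩, hb, -⟩, -⟩
    refine ⟨P, hb, hinj, fun j => ?_, i, not_isZero_of_iso_power hM hai (ha i hi).some⟩
    by_cases hj : ((j : ℝ) : EReal) ≤ sup P
    · exact ⟨a j, ha j hj⟩
    · exact .of_isZero (isZero_homology_of_isZero_X (isZero_X_of_not_le_sup hj))
  · rintro ⟨P, hb, hinj, hpow, i, hi⟩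
    choose a ha using hpow
    refine ⟨_, ⟨P, ⟨hb.2, hinj, a, ⟨i, ?_, ?_⟩, fun j _ => ha j⟩, hb, rfl⟩, ?_⟩
    · by_contra h
      exact hi (isZero_homology_of_isZero_X (isZero_X_of_not_le_sup h))
    · intro h0
      have := ha i
      rw [h0] at this
      exact hi (.of_iso ((IsZero.iff_id_eq_zero _).2
        (biproduct.hom_ext _ _ fun i => i.elim0)) this.some)
    · exact EReal_sub_lt_top
        (lt_of_le_of_lt (sInf_le ⟨i, hi, rfl⟩) (EReal.coe_lt_top (i : ℝ))) (bot_lt_inf hb.1)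

/-! ### Powers of a scalar that kills homology become null-homotopic. -/

section NullHomotopy

variable {R : Type*} [CommRing R] [Linear R A]

theorem smul_homologyπ_eq_zero {ι : Type*} {c : ComplexShape ι} {P : HomologicalComplex A c}
    {r : R} {i : ι} (h : r • 𝟙 (P.homology i) = 0) : r • P.homologyπ i = 0 := by
  rw [← Category.comp_id (P.homologyπ i), ← Linear.comp_smul, h, comp_zero]

theorem smul_homologyι_eq_zero {ι : Type*} {c : ComplexShape ι} {P : HomologicalComplex A c}
    {r : R} {i : ι} (h : r • 𝟙 (P.homology i) = 0) : r • P.homologyι i = 0 := by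
  rw [← Category.id_comp (P.homologyι i), ← Linear.smul_comp, h, zero_comp]

/-- If `r` kills the homology of a bounded below complex of projectives, then `r ^ k` is
homotopic to an endomorphism vanishing in the `k` lowest degrees. -/
theorem exists_homotopy_pow_smul_of_projective (P : ChainComplex A ℤ)
    (hP : ∀ i, Projective (P.X i)) (r : R) (hr : ∀ i, r • 𝟙 (P.homology i) = 0) (b : ℤ)
    (hb : ∀ i < b, IsZero (P.X i)) (k : ℕ) :
    ∃ φ : P ⟶ P, Nonempty (Homotopy (r ^ k • 𝟙 P) φ) ∧ ∀ i < b + k, φ.f i = 0 := by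
  induction k with
  | zero =>
    exact ⟨_, ⟨Homotopy.refl _⟩, fun i hi => (hb i (by simpa using hi)).eq_of_src _ _⟩
  | succ k ih =>
    obtain ⟨φ, ⟨H⟩, hφ⟩ := ih
    have key : ∀ i j, (ComplexShape.down ℤ).Rel j i → ∃ h : P.X i ⟶ P.X j,
        (i = b + k → h ≫ P.d j i = r • φ.f i) ∧ (i ≠ b + k → h = 0) := by
      intro i j hij
      -- Only the lowest degree where `φ` may be nonzero needs correction. There `φ` lands in
      -- cycles, so `r • φ` lands in boundaries and lifts through the differential by projectivity.
      by_cases hi : i = b + k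
      · have := hP i
        have hd : φ.f i ≫ P.d i (i - 1) = 0 := by
          rw [φ.comm, hφ (i - 1) (by lia), comp_zero]
        let z : P.X i ⟶ P.cycles i := P.liftCycles (φ.f i) (i - 1) (by simp) hd
        have hex : (ShortComplex.mk (P.toCycles j i) (P.homologyπ i) (by simp)).Exact :=
          ShortComplex.exact_of_g_is_cokernel _
            (P.homologyIsCokernel j i ((ComplexShape.down ℤ).prev_eq' hij))
        have hz : (r • z) ≫ P.homologyπ i = 0 := by
          rw [Linear.smul_comp, ← Linear.comp_smul, smul_homologyπ_eq_zero (hr i), comp_zero]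
        have hl := hex.liftFromProjective_comp (r • z) hz
        refine ⟨hex.liftFromProjective (r • z) hz, fun _ => ?_, fun h => absurd hi h⟩
        rw [← P.toCycles_i, ← Category.assoc]
        dsimp only at hl
        rw [hl]
        simp [z]
      · exact ⟨0, fun h => absurd h hi, fun _ => rfl⟩
    choose h h₁ h₂ using key
    refine ⟨r • φ - Homotopy.nullHomotopicMap' h, ⟨?_⟩, fun i hi => ?_⟩
    · rw [pow_succ', mul_smul]
      exact (H.smul r).trans ((Homotopy.equivSubZero.symm
        ((Homotopy.ofEq (sub_sub_cancel _ _)).trans (Homotopy.nullHomotopy' h))))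
    · have r₁ : (ComplexShape.down ℤ).Rel (i + 1) i := by simp
      have r₀ : (ComplexShape.down ℤ).Rel i (i - 1) := by simp
      rw [HomologicalComplex.sub_f_apply, HomologicalComplex.smul_f_apply,
        Homotopy.nullHomotopicMap'_f r₁ r₀, h₂ (i - 1) i r₀ (by push_cast at hi; lia),
        comp_zero, zero_add]
      by_cases hi' : i = b + k
      · rw [h₁ i _ r₁ hi', sub_self]
      · rw [h₂ i _ r₁ hi', hφ i (by push_cast at hi; lia), zero_comp, smul_zero, sub_zero]

/-- If `r` kills the homology of a bounded above complex of injectives, then `r ^ k` is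
homotopic to an endomorphism vanishing in the `k` highest degrees. -/
theorem exists_homotopy_pow_smul_of_injective (I : ChainComplex A ℤ)
    (hI : ∀ i, Injective (I.X i)) (r : R) (hr : ∀ i, r • 𝟙 (I.homology i) = 0) (b : ℤ)
    (hb : ∀ i > b, IsZero (I.X i)) (k : ℕ) :
    ∃ φ : I ⟶ I, Nonempty (Homotopy (r ^ k • 𝟙 I) φ) ∧ ∀ i > b - k, φ.f i = 0 := by
  induction k with
  | zero =>
    exact ⟨_, ⟨Homotopy.refl _⟩, fun i hi => (hb i (by simpa using hi)).eq_of_src _ _⟩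
  | succ k ih =>
    obtain ⟨φ, ⟨H⟩, hφ⟩ := ih
    have key : ∀ j i, (ComplexShape.down ℤ).Rel i j → ∃ h : I.X j ⟶ I.X i,
        (i = b - k → I.d i j ≫ h = r • φ.f i) ∧ (i ≠ b - k → h = 0) := by
      intro j i hij
      -- Dually, in the top remaining degree `φ` kills boundaries, so `r • φ` kills cycles and
      -- extends along the differential by injectivity.
      by_cases hi : i = b - k
      · have := hI i
        have hd : I.d (i + 1) i ≫ φ.f i = 0 := by
          rw [← φ.comm, hφ (i + 1) (by lia), zero_comp]
        let z : I.opcycles i ⟶ I.X i := I.descOpcycles (φ.f i) (i + 1) (by simp) hd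
        have hex : (ShortComplex.mk (I.homologyι i) (I.fromOpcycles i j) (by simp)).Exact :=
          ShortComplex.exact_of_f_is_kernel _
            (I.homologyIsKernel i j ((ComplexShape.down ℤ).next_eq' hij))
        have hz : I.homologyι i ≫ (r • z) = 0 := by
          rw [Linear.comp_smul, ← Linear.smul_comp, smul_homologyι_eq_zero (hr i), zero_comp]
        have hl := hex.comp_descToInjective (r • z) hz
        refine ⟨hex.descToInjective (r • z) hz, fun _ => ?_, fun h => absurd hi h⟩
        rw [← I.p_fromOpcycles, Category.assoc]
        dsimp only at hl
        rw [hl]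
        simp [z]
      · exact ⟨0, fun h => absurd h hi, fun _ => rfl⟩
    choose h h₁ h₂ using key
    refine ⟨r • φ - Homotopy.nullHomotopicMap' h, ⟨?_⟩, fun i hi => ?_⟩
    · rw [pow_succ', mul_smul]
      exact (H.smul r).trans ((Homotopy.equivSubZero.symm
        ((Homotopy.ofEq (sub_sub_cancel _ _)).trans (Homotopy.nullHomotopy' h))))
    · have r₁ : (ComplexShape.down ℤ).Rel (i + 1) i := by simp
      have r₀ : (ComplexShape.down ℤ).Rel i (i - 1) := by simp
      rw [HomologicalComplex.sub_f_apply, HomologicalComplex.smul_f_apply,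
        Homotopy.nullHomotopicMap'_f r₁ r₀, h₂ i (i + 1) r₁ (by push_cast at hi; lia),
        zero_comp, add_zero]
      by_cases hi' : i = b - k
      · rw [h₁ _ i r₀ hi', sub_self]
      · rw [h₂ _ i r₀ hi', hφ i (by push_cast at hi; lia), comp_zero, smul_zero, sub_zero]

theorem homotopy_pow_smul_zero_of_le {ι : Type*} {c : ComplexShape ι}
    {P : HomologicalComplex A c} {r : R} {m n : ℕ}
    (hmn : m ≤ n) (h : Nonempty (Homotopy (r ^ m • 𝟙 P) 0)) :
    Nonempty (Homotopy (r ^ n • 𝟙 P) 0) := by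
  obtain ⟨h⟩ := h
  obtain ⟨l, rfl⟩ := Nat.exists_eq_add_of_le' hmn
  rw [pow_add, mul_smul]
  exact ⟨(h.smul (r ^ l)).trans (Homotopy.ofEq (smul_zero _))⟩

theorem exists_homotopy_pow_smul_zero_of_projective (P : ChainComplex A ℤ) (hb : IsBdd P)
    (hP : ∀ i, Projective (P.X i)) (r : R) (hr : ∀ i, r • 𝟙 (P.homology i) = 0) :
    ∃ N : ℕ, ∀ n ≥ N, Nonempty (Homotopy (r ^ n • 𝟙 P) 0) := by
  obtain ⟨⟨b, hb⟩, ⟨t, ht⟩⟩ := hb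
  -- One factor of `r` for each degree in `[b, t]`.
  refine ⟨(t + 1 - b).toNat, fun n hn => homotopy_pow_smul_zero_of_le hn ?_⟩
  obtain ⟨φ, hφ, h0⟩ := exists_homotopy_pow_smul_of_projective P hP r hr b
    (fun i hi => by_contra fun h => absurd (hb h) (not_le.2 hi)) (t + 1 - b).toNat
  obtain rfl : φ = 0 := by
    ext i
    by_cases hi : IsZero (P.X i)
    · exact hi.eq_of_src _ _
    · exact h0 i (by have := ht hi; lia)
  exact hφ

theorem exists_homotopy_pow_smul_zero_of_injective (I : ChainComplex A ℤ) (hb : IsBdd I)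
    (hI : ∀ i, Injective (I.X i)) (r : R) (hr : ∀ i, r • 𝟙 (I.homology i) = 0) :
    ∃ N : ℕ, ∀ n ≥ N, Nonempty (Homotopy (r ^ n • 𝟙 I) 0) := by
  obtain ⟨⟨b, hb⟩, ⟨t, ht⟩⟩ := hb
  refine ⟨(t + 1 - b).toNat, fun n hn => homotopy_pow_smul_zero_of_le hn ?_⟩
  obtain ⟨φ, hφ, h0⟩ := exists_homotopy_pow_smul_of_injective I hI r hr t
    (fun i hi => by_contra fun h => absurd (ht h) (not_le.2 hi)) (t + 1 - b).toNat
  obtain rfl : φ = 0 := by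
    ext i
    by_cases hi : IsZero (I.X i)
    · exact hi.eq_of_src _ _
    · exact h0 i (by have := hb hi; lia)
  exact hφ

end NullHomotopy

/-! ### Splitting of long exact homology sequences by a null-homotopy. -/

section Splitting

variable {ι : Type*} {c : ComplexShape ι} {S : ShortComplex (HomologicalComplex A c)}

open HomologicalComplex

/-- If the first map of a short exact sequence of complexes is null-homotopic, then the homology
of the third complex splits. -/
theorem nonempty_homology_iso_of_homotopy_f (hS : S.ShortExact) (h : Homotopy S.f 0) (i j : ι)
    (hij : c.Rel i j) : Nonempty (S.X₃.homology i ≅ S.X₂.homology i ⊞ S.X₁.homology j) := by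
  have hdh : S.X₁.iCycles j ≫ h.hom j i ≫ S.X₂.d i j = S.X₁.iCycles j ≫ S.f.f j := by
    have := h.comm j
    rw [prevD_eq _ hij] at this
    rw [this]
    by_cases hj : c.Rel j (c.next j)
    · simp [dNext_eq _ hj]
    · simp [dNext_eq_zero _ _ hj]
  -- For a cycle `z`, `d(hz) = f z`; hence `g(hz)` is a cycle whose connecting image is `[z]`. This
  -- gives a section of `δ`.
  let x : S.X₁.cycles j ⟶ S.X₃.X i := S.X₁.iCycles j ≫ h.hom j i ≫ S.g.f i
  have hx : x ≫ S.X₃.d i j = 0 := by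
    have e : S.f.f j ≫ S.g.f j = 0 := by rw [← comp_f, S.zero, zero_f]
    simp only [x, Category.assoc, S.g.comm]
    rw [reassoc_of% hdh, e, comp_zero]
  let σ : S.X₁.cycles j ⟶ S.X₃.homology i :=
    S.X₃.liftCycles x j (c.next_eq' hij) hx ≫ S.X₃.homologyπ i
  have hσδ : σ ≫ hS.δ i j hij = S.X₁.homologyπ j := by
    have := hS.δ_eq i j hij x hx (S.X₁.iCycles j ≫ h.hom j i) (by simp [x]) (S.X₁.iCycles j)
      (by simp [hdh]) _ rfl
    simp only [σ, Category.assoc]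
    rw [this]
    convert Category.id_comp _
    rw [← cancel_mono (S.X₁.iCycles j)]
    simp
  -- On a boundary, `h(dy) = f y - d(hy)`, and `g` sends this to the boundary `-d(g(hy))`.
  have hσ : S.X₁.toCycles i j ≫ σ = 0 := by
    have e : S.X₁.d i j ≫ h.hom j i = S.f.f i - prevD i h.hom := by
      have := h.comm i
      rw [dNext_eq _ hij] at this
      rw [this]
      simp
    have e' : S.f.f i ≫ S.g.f i = 0 := by rw [← comp_f, S.zero, zero_f]
    by_cases hi : c.Rel (c.prev i) i
    · rw [prevD_eq _ hi] at e
      have : S.X₁.toCycles i j ≫ S.X₃.liftCycles x j (c.next_eq' hij) hx =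
          (-(h.hom i (c.prev i)) ≫ S.g.f _) ≫ S.X₃.toCycles (c.prev i) i := by
        rw [← cancel_mono (S.X₃.iCycles i)]
        simp only [Category.assoc, liftCycles_i, toCycles_i, x, toCycles_i_assoc]
        rw [reassoc_of% e, Preadditive.sub_comp, e']
        simp
      simp only [σ]
      rw [reassoc_of% this]
      simp
    · rw [prevD_eq_zero _ _ hi, sub_zero] at e
      have : S.X₁.toCycles i j ≫ S.X₃.liftCycles x j (c.next_eq' hij) hx = 0 := by
        rw [← cancel_mono (S.X₃.iCycles i)]
        simp only [Category.assoc, liftCycles_i, x, toCycles_i_assoc]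
        rw [reassoc_of% e, e', zero_comp]
      simp only [σ]
      rw [reassoc_of% this, zero_comp]
  let s : S.X₁.homology j ⟶ S.X₃.homology i :=
    (S.X₁.homologyIsCokernel i j (c.prev_eq' hij)).desc (CokernelCofork.ofπ σ hσ)
  have hs : S.X₁.homologyπ j ≫ s = σ :=
    (S.X₁.homologyIsCokernel i j (c.prev_eq' hij)).fac (CokernelCofork.ofπ σ hσ)
      WalkingParallelPair.one
  have hsδ : s ≫ hS.δ i j hij = 𝟙 _ := by
    rw [← cancel_epi (S.X₁.homologyπ j), reassoc_of% hs, hσδ, Category.comp_id]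
  have hmono : Mono (homologyMap S.g i) := by
    refine (hS.homology_exact₂ i).mono_g ?_
    exact (h.homologyMap_eq i).trans (homologyMap_zero _ _ _)
  let sp := ShortComplex.Splitting.ofExactOfSection _ (hS.homology_exact₃ i j hij) s hsδ hmono
  exact ⟨sp.isoBinaryBiproduct⟩

/-- If the second map of a short exact sequence of complexes is null-homotopic, then the homology
of the first complex splits. -/
theorem nonempty_homology_iso_of_homotopy_g (hS : S.ShortExact) (h : Homotopy S.g 0) (i j : ι)
    (hij : c.Rel i j) : Nonempty (S.X₁.homology j ≅ S.X₃.homology i ⊞ S.X₂.homology j) := by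
  have hdh : S.X₂.d i j ≫ h.hom j i ≫ S.X₃.pOpcycles i = S.g.f i ≫ S.X₃.pOpcycles i := by
    have := h.comm i
    rw [dNext_eq _ hij] at this
    rw [this]
    by_cases hi : c.Rel (c.prev i) i
    · simp [prevD_eq _ hi]
    · simp [prevD_eq_zero _ _ hi]
  have e' (k) : S.f.f k ≫ S.g.f k = 0 := by rw [← comp_f, S.zero, zero_f]
  -- The retraction of `δ` sends `[z]` to the class of `h(f z)`; it is built modulo boundaries and
  -- then shown to land in homology.
  let x : S.X₁.X j ⟶ S.X₃.opcycles i := S.f.f j ≫ h.hom j i ≫ S.X₃.pOpcycles i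
  have hx : S.X₁.d i j ≫ x = 0 := by
    simp only [x]
    rw [← reassoc_of% S.f.comm i j, hdh, reassoc_of% e' i, zero_comp]
  let ρ : S.X₁.homology j ⟶ S.X₃.opcycles i :=
    S.X₁.homologyι j ≫ S.X₁.descOpcycles x i (c.prev_eq' hij) hx
  have hρ : ρ ≫ S.X₃.fromOpcycles i j = 0 := by
    rw [← cancel_epi (S.X₁.homologyπ j)]
    have e : h.hom j i ≫ S.X₃.d i j = S.g.f j - dNext j h.hom := by
      have := h.comm j
      rw [prevD_eq _ hij] at this
      rw [this]
      simp
    simp only [ρ, homology_π_ι_assoc, Category.assoc, comp_zero, p_descOpcycles_assoc, x,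
      p_fromOpcycles]
    rw [e, Preadditive.comp_sub, e', zero_sub]
    by_cases hj : c.Rel j (c.next j)
    · rw [dNext_eq _ hj, Preadditive.comp_neg, ← Category.assoc (S.f.f j), S.f.comm]
      simp
    · rw [dNext_eq_zero _ _ hj]
      simp
  let s : S.X₁.homology j ⟶ S.X₃.homology i :=
    (S.X₃.homologyIsKernel i j (c.next_eq' hij)).lift (KernelFork.ofι ρ hρ)
  have hs : s ≫ S.X₃.homologyι i = ρ :=
    (S.X₃.homologyIsKernel i j (c.next_eq' hij)).fac (KernelFork.ofι ρ hρ)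
      WalkingParallelPair.zero
  have hδs : hS.δ i j hij ≫ s = 𝟙 _ := by
    rw [← cancel_mono (S.X₃.homologyι i), Category.assoc, hs, Category.id_comp,
      ← cancel_epi (S.X₃.homologyπ i)]
    have := hS.epi_g
    -- The pullback supplies a generalized element `x₂` lifting the universal cycle along `g`. If `f
    -- x₁ = d x₂`, then `h(f x₁) = h(d x₂)`, which equals `g x₂` modulo boundaries.
    let x₂ := pullback.fst (S.g.f i) (S.X₃.iCycles i)
    let q := pullback.snd (S.g.f i) (S.X₃.iCycles i)
    have hq : x₂ ≫ S.g.f i = q ≫ S.X₃.iCycles i := pullback.condition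
    rw [← cancel_epi q]
    have hz : (x₂ ≫ S.X₂.d i j) ≫ S.g.f j = 0 := by
      rw [Category.assoc, ← S.g.comm, reassoc_of% hq]
      simp
    have hSj := hS.map_of_exact (eval A c j)
    have := hSj.mono_f
    obtain ⟨x₁, hx₁⟩ : ∃ x₁ : pullback (S.g.f i) (S.X₃.iCycles i) ⟶ S.X₁.X j,
        x₁ ≫ S.f.f j = x₂ ≫ S.X₂.d i j :=
      ⟨hSj.exact.lift (x₂ ≫ S.X₂.d i j) hz, hSj.exact.lift_f _ hz⟩
    have := hS.δ_eq i j hij (q ≫ S.X₃.iCycles i) (by simp) x₂ hq x₁ hx₁ _ rfl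
    have e : S.X₃.liftCycles (q ≫ S.X₃.iCycles i) j (c.next_eq' hij) (by simp) = q := by
      rw [← cancel_mono (S.X₃.iCycles i)]
      simp
    rw [e] at this
    rw [reassoc_of% this]
    simp only [ρ, homology_π_ι_assoc, p_descOpcycles, x, homology_π_ι, liftCycles_i_assoc]
    rw [reassoc_of% hx₁, hdh, reassoc_of% hq]
  have hepi : Epi (homologyMap S.f j) := by
    refine (hS.homology_exact₂ j).epi_f ?_
    exact (h.homologyMap_eq j).trans (homologyMap_zero _ _ _)
  let sp := ShortComplex.Splitting.ofExactOfRetraction _ (hS.homology_exact₁ i j hij) s hδs hepi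
  exact ⟨sp.isoBinaryBiproduct⟩

end Splitting

/-! ### Contractible covers and hulls; complexes of objects of dimension at most one. -/

theorem isZero_homology_of_homotopy_id {ι : Type*} {c : ComplexShape ι}
    {C : HomologicalComplex A c} (h : Homotopy (𝟙 C) 0) (i : ι) : IsZero (C.homology i) := by
  rw [IsZero.iff_id_eq_zero, ← HomologicalComplex.homologyMap_id, h.homologyMap_eq,
    HomologicalComplex.homologyMap_zero]

/-- The direct sum of the contractible complexes `G i = G i` concentrated in degrees `i`
and `i - 1`. -/
def projectiveDisks (G : ℤ → A) : ChainComplex A ℤ where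
  X i := G i ⊞ G (i + 1)
  d i j := if h : i = j + 1 then biprod.fst ≫ eqToHom (congrArg G h) ≫ biprod.inr else 0
  shape i j h := dif_neg fun h' => h h'.symm
  d_comp_d' i j k _ _ := by
    split_ifs <;> simp

theorem projectiveDisks_d (G : ℤ → A) (i j : ℤ) (h : i = j + 1) :
    (projectiveDisks G).d i j = biprod.fst ≫ eqToHom (congrArg G h) ≫ biprod.inr :=
  dif_pos h

/-- The complex `projectiveDisks G` is contractible. -/
def projectiveDisksHomotopy (G : ℤ → A) : Homotopy (𝟙 (projectiveDisks G)) 0 where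
  hom i j := if h : j = i + 1 then biprod.snd ≫ eqToHom (congrArg G h).symm ≫ biprod.inl else 0
  zero i j h := dif_neg fun h' => h h'.symm
  comm i := by
    have r₁ : (ComplexShape.down ℤ).Rel (i + 1) i := by simp
    have r₀ : (ComplexShape.down ℤ).Rel i (i - 1) := by simp
    rw [HomologicalComplex.zero_f, add_zero, dNext_eq _ r₀, prevD_eq _ r₁,
      projectiveDisks_d G i (i - 1) (by simp),
      projectiveDisks_d G (i + 1) i rfl, dif_pos rfl, dif_pos (by simp)]
    change 𝟙 (G i ⊞ G (i + 1)) =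
      (biprod.fst ≫ eqToHom (congrArg G (by simp)) ≫
        (biprod.inr : G (i - 1 + 1) ⟶ G (i - 1) ⊞ G (i - 1 + 1))) ≫
        (biprod.snd ≫ eqToHom (congrArg G (by simp)) ≫ (biprod.inl : _ ⟶ G i ⊞ G (i + 1))) +
      (biprod.snd ≫ eqToHom rfl ≫ (biprod.inl : G (i + 1) ⟶ G (i + 1) ⊞ G (i + 1 + 1))) ≫
        (biprod.fst ≫ eqToHom rfl ≫ (biprod.inr : _ ⟶ G i ⊞ G (i + 1)))
    simp only [Category.assoc,
      biprod.inr_snd_assoc, eqToHom_trans_assoc, eqToHom_refl, Category.id_comp,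
      biprod.inl_fst_assoc]
    exact (biprod.total (X := G i) (Y := G (i + 1))).symm

/-- The map from `projectiveDisks G` to a complex induced by degreewise maps. -/
def projectiveDisksDesc {G : ℤ → A} {C : ChainComplex A ℤ} (π : ∀ i, G i ⟶ C.X i) :
    projectiveDisks G ⟶ C where
  f i := biprod.desc (π i) (π (i + 1) ≫ C.d (i + 1) i)
  comm' i j hij := by
    obtain rfl : j + 1 = i := hij
    rw [projectiveDisks_d G (j + 1) j rfl]
    change biprod.desc (π (j + 1)) (π (j + 1 + 1) ≫ C.d (j + 1 + 1) (j + 1)) ≫ C.d (j + 1) j =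
      (biprod.fst ≫ eqToHom rfl ≫ biprod.inr) ≫ biprod.desc (π j) (π (j + 1) ≫ C.d (j + 1) j)
    ext <;> simp

/-- The product of the contractible complexes `G i = G i` concentrated in degrees `i + 1`
and `i`. -/
def injectiveDisks (G : ℤ → A) : ChainComplex A ℤ where
  X i := G i ⊞ G (i - 1)
  d i j := if h : i - 1 = j then biprod.snd ≫ eqToHom (congrArg G h) ≫ biprod.inl else 0
  shape i j h := dif_neg fun h' => h (sub_eq_iff_eq_add.1 h').symm
  d_comp_d' i j k _ _ := by
    split_ifs <;> simp

theorem injectiveDisks_d (G : ℤ → A) (i j : ℤ) (h : i - 1 = j) :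
    (injectiveDisks G).d i j = biprod.snd ≫ eqToHom (congrArg G h) ≫ biprod.inl :=
  dif_pos h

/-- The complex `injectiveDisks G` is contractible. -/
def injectiveDisksHomotopy (G : ℤ → A) : Homotopy (𝟙 (injectiveDisks G)) 0 where
  hom i j := if h : j - 1 = i then biprod.fst ≫ eqToHom (congrArg G h).symm ≫ biprod.inr else 0
  zero i j h := dif_neg fun h' => h (sub_eq_iff_eq_add.1 h').symm
  comm i := by
    have r₁ : (ComplexShape.down ℤ).Rel (i + 1) i := by simp
    have r₀ : (ComplexShape.down ℤ).Rel i (i - 1) := by simp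
    rw [HomologicalComplex.zero_f, add_zero, dNext_eq _ r₀, prevD_eq _ r₁,
      injectiveDisks_d G i (i - 1) rfl,
      injectiveDisks_d G (i + 1) i (by simp), dif_pos rfl, dif_pos (by simp)]
    change 𝟙 (G i ⊞ G (i - 1)) =
      (biprod.snd ≫ eqToHom rfl ≫ (biprod.inl : _ ⟶ G (i - 1) ⊞ G (i - 1 - 1))) ≫
        (biprod.fst ≫ eqToHom rfl ≫ (biprod.inr : _ ⟶ G i ⊞ G (i - 1))) +
      (biprod.fst ≫ eqToHom (congrArg G (by simp)) ≫
        (biprod.inr : G (i + 1 - 1) ⟶ G (i + 1) ⊞ G (i + 1 - 1))) ≫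
        (biprod.snd ≫ eqToHom (congrArg G (by simp)) ≫ (biprod.inl : _ ⟶ G i ⊞ G (i - 1)))
    simp only [Category.assoc,
      biprod.inr_snd_assoc, eqToHom_trans_assoc, eqToHom_refl, Category.id_comp,
      biprod.inl_fst_assoc]
    exact (biprod.total (X := G i) (Y := G (i - 1))).symm.trans (add_comm _ _)

/-- The map from a complex to `injectiveDisks G` induced by degreewise maps. -/
def injectiveDisksLift {G : ℤ → A} {C : ChainComplex A ℤ} (π : ∀ i, C.X i ⟶ G i) :
    C ⟶ injectiveDisks G where
  f i := biprod.lift (π i) (C.d i (i - 1) ≫ π (i - 1))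
  comm' i j hij := by
    obtain rfl : i - 1 = j := sub_eq_iff_eq_add.2 hij.symm
    rw [injectiveDisks_d G i (i - 1) rfl]
    change biprod.lift (π i) (C.d i (i - 1) ≫ π (i - 1)) ≫
        (biprod.snd ≫ eqToHom rfl ≫ biprod.inl) =
      C.d i (i - 1) ≫ biprod.lift (π (i - 1)) (C.d (i - 1) (i - 1 - 1) ≫ π (i - 1 - 1))
    ext <;> simp

theorem isZero_biprod {X Y : A} (hX : IsZero X) (hY : IsZero Y) : IsZero (X ⊞ Y) := by
  rw [IsZero.iff_id_eq_zero]
  ext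
  · exact hX.eq_of_src _ _
  · exact hX.eq_of_src _ _
  · exact hY.eq_of_src _ _
  · exact hY.eq_of_src _ _

/-- Covering zero objects by zero objects keeps the disk complex of a bounded complex bounded. -/
theorem exists_projective_epi {B : Type u} [Category.{v} B] [EnoughProjectives B] (X : B) :
    ∃ (G : B) (π : G ⟶ X), Projective G ∧ Epi π ∧ (IsZero X → IsZero G) := by
  by_cases h : IsZero X
  · exact ⟨X, 𝟙 X, h.projective, inferInstance, id⟩
  · exact ⟨Projective.over X, Projective.π X, inferInstance, inferInstance, fun h' => absurd h' h⟩

theorem exists_injective_mono {B : Type u} [Category.{v} B] [EnoughInjectives B] (X : B) :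
    ∃ (G : B) (π : X ⟶ G), Injective G ∧ Mono π ∧ (IsZero X → IsZero G) := by
  by_cases h : IsZero X
  · exact ⟨X, 𝟙 X, h.injective, inferInstance, id⟩
  · exact ⟨Injective.under X, Injective.ι X, inferInstance, inferInstance, fun h' => absurd h' h⟩

/-- A bounded complex of objects of projective dimension at most one has, up to a shift, the
homology of a bounded complex of projectives. -/
theorem exists_projective_complex [EnoughProjectives A] (C : ChainComplex A ℤ) (hb : IsBdd C)
    (hC : ∀ i, HasProjectiveDimensionLT (C.X i) 2) :
    ∃ K : ChainComplex A ℤ, IsBdd K ∧ (∀ i, Projective (K.X i)) ∧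
      ∀ i j, i = j + 1 → Nonempty (C.homology i ≅ K.homology j) := by
  choose G π hG hπ hGC using fun i => exists_projective_epi (C.X i)
  let ρ := projectiveDisksDesc π
  have hρf (i) : Epi (ρ.f i) := by
    have := hπ i
    refine epi_of_epi_fac (f := (biprod.inl : _ ⟶ G i ⊞ G (i + 1)))
      (g := ρ.f i) (h := π i) ?_
    exact biprod.inl_desc _ _
  have hρ : Epi ρ := HomologicalComplex.epi_of_epi_f _ hρf
  let S : ShortComplex (ChainComplex A ℤ) := ShortComplex.mk (kernel.ι ρ) ρ (kernel.condition ρ)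
  have hS : S.ShortExact := { exact := ShortComplex.exact_kernel ρ }
  have hS' (i) := hS.map_of_exact (HomologicalComplex.eval A _ i)
  have hmono (i) : Mono (S.f.f i) := (hS' i).mono_f
  have hz (i : ℤ) (h : ¬ IsZero ((kernel ρ).X i)) : ¬ IsZero (C.X i) ∨ ¬ IsZero (C.X (i + 1)) := by
    by_contra! h'
    exact h (IsZero.of_mono (S.f.f i) (isZero_biprod (hGC _ h'.1) (hGC _ h'.2)))
  refine ⟨kernel ρ, ⟨?_, ?_⟩, fun i => ?_, fun i j hij => ?_⟩
  · obtain ⟨b, hb⟩ := hb.1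
    refine ⟨b - 1, fun i hi => ?_⟩
    rcases hz i hi with h | h <;> have := hb h <;> lia
  · obtain ⟨b, hb⟩ := hb.2
    refine ⟨b, fun i hi => ?_⟩
    rcases hz i hi with h | h <;> have := hb h <;> lia
  · have h₁ := hG i
    have h₂ := hG (i + 1)
    have : Projective ((projectiveDisks G).X i) :=
      inferInstanceAs (Projective (G i ⊞ G (i + 1)))
    rw [projective_iff_hasProjectiveDimensionLT_one]
    -- The kernel of an epimorphism from a projective to an object of projective dimension at most
    -- one is projective.
    exact (hS' i).hasProjectiveDimensionLT_X₁ 1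
      (projective_iff_hasProjectiveDimensionLT_one.1 this) (hC i)
  · exact ⟨hS.δIso i j hij.symm
      (isZero_homology_of_homotopy_id (projectiveDisksHomotopy G) i)
      (isZero_homology_of_homotopy_id (projectiveDisksHomotopy G) j)⟩

/-- A bounded complex of objects of injective dimension at most one has, up to a shift, the
homology of a bounded complex of injectives. -/
theorem exists_injective_complex [EnoughInjectives A] (C : ChainComplex A ℤ) (hb : IsBdd C)
    (hC : ∀ i, HasInjectiveDimensionLT (C.X i) 2) :
    ∃ K : ChainComplex A ℤ, IsBdd K ∧ (∀ i, Injective (K.X i)) ∧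
      ∀ i j, i = j + 1 → Nonempty (K.homology i ≅ C.homology j) := by
  choose G π hG hπ hGC using fun i => exists_injective_mono (C.X i)
  let ρ := injectiveDisksLift π
  have hρf (i) : Mono (ρ.f i) := by
    have := hπ i
    have : Mono (ρ.f i ≫ (biprod.fst : G i ⊞ G (i - 1) ⟶ G i)) := by
      rwa [show ρ.f i ≫ (biprod.fst : G i ⊞ G (i - 1) ⟶ G i) = π i from biprod.lift_fst _ _]
    exact mono_of_mono (ρ.f i) (biprod.fst : G i ⊞ G (i - 1) ⟶ G i)
  have hρ : Mono ρ := HomologicalComplex.mono_of_mono_f _ hρf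
  let S : ShortComplex (ChainComplex A ℤ) :=
    ShortComplex.mk ρ (cokernel.π ρ) (cokernel.condition ρ)
  have hS : S.ShortExact := { exact := ShortComplex.exact_cokernel ρ }
  have hS' (i) := hS.map_of_exact (HomologicalComplex.eval A _ i)
  have hepi (i) : Epi (S.g.f i) := (hS' i).epi_g
  have hz (i : ℤ) (h : ¬ IsZero ((cokernel ρ).X i)) :
      ¬ IsZero (C.X i) ∨ ¬ IsZero (C.X (i - 1)) := by
    by_contra! h'
    exact h (IsZero.of_epi (S.g.f i) (isZero_biprod (hGC _ h'.1) (hGC _ h'.2)))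
  refine ⟨cokernel ρ, ⟨?_, ?_⟩, fun i => ?_, fun i j hij => ?_⟩
  · obtain ⟨b, hb⟩ := hb.1
    refine ⟨b, fun i hi => ?_⟩
    rcases hz i hi with h | h <;> have := hb h <;> lia
  · obtain ⟨b, hb⟩ := hb.2
    refine ⟨b + 1, fun i hi => ?_⟩
    rcases hz i hi with h | h <;> have := hb h <;> lia
  · have h₁ := hG i
    have h₂ := hG (i - 1)
    have : Injective ((injectiveDisks G).X i) :=
      inferInstanceAs (Injective (G i ⊞ G (i - 1)))
    rw [injective_iff_hasInjectiveDimensionLT_one]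
    exact (hS' i).hasInjectiveDimensionLT_X₃ 1
      (injective_iff_hasInjectiveDimensionLT_one.1 this) (hC i)
  · exact ⟨hS.δIso i j hij.symm
      (isZero_homology_of_homotopy_id (injectiveDisksHomotopy G) i)
      (isZero_homology_of_homotopy_id (injectiveDisksHomotopy G) j)⟩

end Abelian

/-! ### Transfer along a fully faithful or faithful exact functor with an adjoint. -/

section Adjunction

variable {A : Type*} [Category* A] [Abelian A] {B : Type*} [Category* B] [Abelian B]
  {G : B ⥤ A} [G.Additive] [PreservesFiniteLimits G] [PreservesFiniteColimits G]
  {Q : Type*} [CommRing Q] [Linear Q A]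

theorem isZero_of_isZero_map {A B : Type*} [Category* A] [HasZeroMorphisms A] [Category* B]
    [HasZeroMorphisms B] {G : B ⥤ A} [G.Faithful] {X : B} (h : IsZero (G.obj X)) : IsZero X := by
  rw [IsZero.iff_id_eq_zero]
  exact G.map_injective (h.eq_of_src _ _)

/-- An exact functor commutes with homology. -/
def mapHomologyIso (G : B ⥤ A) [G.Additive] [PreservesFiniteLimits G] [PreservesFiniteColimits G]
    {ι : Type*} {c : ComplexShape ι} (C : HomologicalComplex B c) (i : ι) :
    ((G.mapHomologicalComplex c).obj C).homology i ≅ G.obj (C.homology i) :=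
  (C.sc i).mapHomologyIso G

theorem isBdd_map {A B : Type*} [Category* A] [Abelian A] [Category* B] [Abelian B]
    (F : A ⥤ B) [F.Additive] {P : ChainComplex A ℤ} (h : IsBdd P) :
    IsBdd ((F.mapHomologicalComplex _).obj P) := by
  have key : {i | ¬ IsZero (((F.mapHomologicalComplex _).obj P).X i)} ⊆ {i | ¬ IsZero (P.X i)} :=
    fun i hi h' => hi (F.map_isZero h')
  exact ⟨h.1.mono key, h.2.mono key⟩

theorem not_isZero_homology_of_map {ι : Type*} {c : ComplexShape ι} {C : HomologicalComplex B c}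
    {i : ι} (h : ¬ IsZero (((G.mapHomologicalComplex c).obj C).homology i)) :
    ¬ IsZero (C.homology i) := fun h' =>
  h (.of_iso (G.map_isZero h') (mapHomologyIso G C i))

theorem not_isZero_homology_map [G.Faithful] {ι : Type*} {c : ComplexShape ι}
    {C : HomologicalComplex B c} {i : ι} (h : ¬ IsZero (C.homology i)) :
    ¬ IsZero (((G.mapHomologicalComplex c).obj C).homology i) := fun h' =>
  h (isZero_of_isZero_map (.of_iso h' (mapHomologyIso G C i).symm))

/-- Here `L` is reduction modulo `r`, and `L P` is the witness: left adjoints of exact functors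
preserve projectives, and the split sequence makes `H_i(P)` a summand of the homology of `L P`,
which is therefore not acyclic. -/
theorem qpd_lt_top_of_homotopy [G.Full] [G.Faithful] {L : A ⥤ B} (adj : L ⊣ G) (r : Q)
    (hses : ∀ X : A, Projective X → ∃ w,
      (ShortComplex.mk (r • 𝟙 X) (adj.unit.app X) w).ShortExact)
    {M : B} (hM : ¬ IsZero M) (P : ChainComplex A ℤ) (hb : IsBdd P)
    (hP : ∀ i, Projective (P.X i)) (hpow : ∀ i, IsFinitePower (G.obj M) (P.homology i))
    (hne : ∃ i, ¬ IsZero (P.homology i)) (h : Homotopy (r • 𝟙 P) 0) : qpd M < ⊤ := by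
  have : L.Additive := adj.left_adjoint_additive
  let C := (L.mapHomologicalComplex _).obj P
  let g : P ⟶ (G.mapHomologicalComplex _).obj C :=
    { f := fun i => adj.unit.app (P.X i)
      comm' := fun i j _ => (adj.unit.naturality (P.d i j)).symm }
  have hw (i) := (hses (P.X i) (hP i)).choose
  let S : ShortComplex (ChainComplex A ℤ) := ShortComplex.mk (r • 𝟙 P) g (by
    ext i
    exact hw i)
  have hS : S.ShortExact := HomologicalComplex.shortExact_of_degreewise_shortExact _
    fun i => (hses (P.X i) (hP i)).choose_spec
  have e (i : ℤ) := nonempty_homology_iso_of_homotopy_f hS h i (i - 1) (by simp)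
  refine (qpd_lt_top_iff hM).2 ⟨C, isBdd_map L hb, fun i => adj.map_projective _ (hP i),
    fun i => .of_map G ?_, ?_⟩
  · exact (((hpow i).biprod (hpow (i - 1))).of_iso (e i).some.symm).of_iso (mapHomologyIso G C i)
  · obtain ⟨i, hi⟩ := hne
    exact ⟨i, not_isZero_homology_of_map (G := G) fun h' =>
      hi (.of_mono (biprod.inl ≫ (e i).some.inv) h')⟩

theorem qid_lt_top_of_homotopy [G.Full] [G.Faithful] {T : A ⥤ B} (adj : G ⊣ T) (r : Q)
    (hses : ∀ X : A, Injective X → ∃ w,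
      (ShortComplex.mk (adj.counit.app X) (r • 𝟙 X) w).ShortExact)
    {M : B} (hM : ¬ IsZero M) (P : ChainComplex A ℤ) (hb : IsBdd P)
    (hP : ∀ i, Injective (P.X i)) (hpow : ∀ i, IsFinitePower (G.obj M) (P.homology i))
    (hne : ∃ i, ¬ IsZero (P.homology i)) (h : Homotopy (r • 𝟙 P) 0) : qid M < ⊤ := by
  have : T.Additive := adj.right_adjoint_additive
  let C := (T.mapHomologicalComplex _).obj P
  let g : (G.mapHomologicalComplex _).obj C ⟶ P :=
    { f := fun i => adj.counit.app (P.X i)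
      comm' := fun i j _ => (adj.counit.naturality (P.d i j)).symm }
  have hw (i) := (hses (P.X i) (hP i)).choose
  let S : ShortComplex (ChainComplex A ℤ) := ShortComplex.mk g (r • 𝟙 P) (by
    ext i
    exact hw i)
  have hS : S.ShortExact := HomologicalComplex.shortExact_of_degreewise_shortExact _
    fun i => (hses (P.X i) (hP i)).choose_spec
  have e (i : ℤ) := nonempty_homology_iso_of_homotopy_g hS h (i + 1) i (by simp)
  refine (qid_lt_top_iff hM).2 ⟨C, isBdd_map T hb, fun i => adj.map_injective _ (hP i),
    fun i => .of_map G ?_, ?_⟩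
  · exact (((hpow (i + 1)).biprod (hpow i)).of_iso (e i).some.symm).of_iso (mapHomologyIso G C i)
  · obtain ⟨i, hi⟩ := hne
    exact ⟨i, not_isZero_homology_of_map (G := G) fun h' =>
      hi (.of_mono (biprod.inr ≫ (e i).some.inv) h')⟩

/-- A projective `F` covering `G X` makes `X` a retract of `L F`, and `0 → F → F → G (L F) → 0`
bounds the projective dimension of `G (L F)` by one. -/
theorem hasProjectiveDimensionLT_two_map {A B : Type*} [Category* A] [Abelian A] [Category* B]
    {G : B ⥤ A} [Linear Q A] [G.Faithful] [EnoughProjectives A] {L : A ⥤ B}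
    (adj : L ⊣ G) (r : Q)
    (hses : ∀ X : A, Projective X → ∃ w,
      (ShortComplex.mk (r • 𝟙 X) (adj.unit.app X) w).ShortExact)
    (X : B) [Projective X] : HasProjectiveDimensionLT (G.obj X) 2 := by
  let π := Projective.π (G.obj X)
  let p := (adj.homEquiv _ _).symm π
  have hp : adj.unit.app _ ≫ G.map p = π := by
    exact (adj.homEquiv_unit (X := Projective.over (G.obj X)) (f := p)).symm.trans
      (Equiv.apply_symm_apply _ _)
  have : Epi (G.map p) := epi_of_epi_fac hp
  have : Epi p := G.epi_of_epi_map this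
  let R : Retract X (L.obj (Projective.over (G.obj X))) :=
    { i := Projective.factorThru (𝟙 X) p
      r := p }
  obtain ⟨w, hS⟩ := hses (Projective.over (G.obj X)) inferInstance
  have h : HasProjectiveDimensionLT (Projective.over (G.obj X)) 1 := inferInstance
  have : HasProjectiveDimensionLT (G.obj (L.obj (Projective.over (G.obj X)))) 2 :=
    hS.hasProjectiveDimensionLT_X₃ 1 h (hasProjectiveDimensionLT_of_ge _ 1 2 one_le_two)
  exact (R.map G).hasProjectiveDimensionLT 2

theorem hasInjectiveDimensionLT_two_map {A B : Type*} [Category* A] [Abelian A] [Category* B]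
    {G : B ⥤ A} [Linear Q A] [G.Faithful] [EnoughInjectives A] {T : A ⥤ B}
    (adj : G ⊣ T) (r : Q)
    (hses : ∀ X : A, Injective X → ∃ w,
      (ShortComplex.mk (adj.counit.app X) (r • 𝟙 X) w).ShortExact)
    (X : B) [Injective X] : HasInjectiveDimensionLT (G.obj X) 2 := by
  let π := Injective.ι (G.obj X)
  let p := adj.homEquiv _ _ π
  have hp : G.map p ≫ adj.counit.app _ = π := by
    exact (adj.homEquiv_counit (Y := Injective.under (G.obj X)) (g := p)).symm.trans
      (Equiv.symm_apply_apply _ _)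
  have : Mono (G.map p) := mono_of_mono_fac hp
  have : Mono p := G.mono_of_mono_map this
  let R : Retract X (T.obj (Injective.under (G.obj X))) :=
    { i := p
      r := Injective.factorThru (𝟙 X) p }
  obtain ⟨w, hS⟩ := hses (Injective.under (G.obj X)) inferInstance
  have h : HasInjectiveDimensionLT (Injective.under (G.obj X)) 1 := inferInstance
  have : HasInjectiveDimensionLT (G.obj (T.obj (Injective.under (G.obj X)))) 2 :=
    hS.hasInjectiveDimensionLT_X₁ 1 h (hasInjectiveDimensionLT_of_ge _ 1 2 one_le_two)
  exact (R.map G).hasInjectiveDimensionLT 2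

theorem qpd_map_lt_top [G.Faithful] [EnoughProjectives A]
    (hG : ∀ X : B, Projective X → HasProjectiveDimensionLT (G.obj X) 2) {M : B}
    (h : qpd M < ⊤) : qpd (G.obj M) < ⊤ := by
  by_cases hM : IsZero M
  · exact qpd_lt_top_of_isZero (G.map_isZero hM)
  obtain ⟨P, hb, hP, hpow, i, hi⟩ := (qpd_lt_top_iff hM).1 h
  obtain ⟨K, hKb, hK, e⟩ := exists_projective_complex ((G.mapHomologicalComplex _).obj P)
    (isBdd_map G hb) fun i => hG _ (hP i)
  refine (qpd_lt_top_iff fun h => hM (isZero_of_isZero_map h)).2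
    ⟨K, hKb, hK, fun j => ?_, i - 1, fun h => ?_⟩
  · exact (((hpow (j + 1)).map G).of_iso (mapHomologyIso G P (j + 1)).symm).of_iso
      (e (j + 1) j rfl).some
  · exact not_isZero_homology_map (G := G) hi (.of_iso h (e i (i - 1) (by simp)).some)

theorem qid_map_lt_top [G.Faithful] [EnoughInjectives A]
    (hG : ∀ X : B, Injective X → HasInjectiveDimensionLT (G.obj X) 2) {M : B}
    (h : qid M < ⊤) : qid (G.obj M) < ⊤ := by
  by_cases hM : IsZero M
  · exact qid_lt_top_of_isZero (G.map_isZero hM)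
  obtain ⟨P, hb, hP, hpow, i, hi⟩ := (qid_lt_top_iff hM).1 h
  obtain ⟨K, hKb, hK, e⟩ := exists_injective_complex ((G.mapHomologicalComplex _).obj P)
    (isBdd_map G hb) fun i => hG _ (hP i)
  refine (qid_lt_top_iff fun h => hM (isZero_of_isZero_map h)).2
    ⟨K, hKb, hK, fun j => ?_, i + 1, fun h => ?_⟩
  · exact (((hpow (j - 1)).map G).of_iso (mapHomologyIso G P (j - 1)).symm).of_iso
      (e j (j - 1) (by simp)).some.symm
  · exact not_isZero_homology_map (G := G) hi (.of_iso h (e (i + 1) i rfl).some.symm)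

end Adjunction

/-! ### Reduction modulo `r` and `r`-torsion as adjoints of restriction. -/

section ChangeOfRings

open scoped Pointwise

variable {Q : Type u} [CommRing Q]

theorem full_restrictScalars {S : Type*} [CommRing S] (φ : Q →+* S)
    (hφ : Function.Surjective φ) : (ModuleCat.restrictScalars.{w} φ).Full where
  map_surjective {X Y} g := by
    refine ⟨ModuleCat.ofHom (X := X) (Y := Y)
      { toFun := g.hom, map_add' := g.hom.map_add, map_smul' := fun s x => ?_ }, rfl⟩
    obtain ⟨q, rfl⟩ := hφ s
    exact g.hom.map_smul q x

variable (r : Q)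

/-- Restriction of scalars along `Q → Q/(r)`. -/
abbrev restrict : ModuleCat.{w} (Q ⧸ Ideal.span {r}) ⥤ ModuleCat.{w} Q :=
  ModuleCat.restrictScalars (Ideal.Quotient.mk (Ideal.span {r}))

instance : (restrict.{u, w} r).Full := full_restrictScalars _ Ideal.Quotient.mk_surjective

theorem smul_restrict_eq_zero (Y : ModuleCat.{w} (Q ⧸ Ideal.span {r}))
    (y : (restrict r).obj Y) : r • y = 0 := by
  change (Ideal.Quotient.mk (Ideal.span {r}) r • (y : Y) : Y) = 0
  rw [Ideal.Quotient.eq_zero_iff_mem.2 (Ideal.mem_span_singleton_self r), zero_smul]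

/-- The quotient `X / rX` as a `Q/(r)`-module. -/
abbrev quotObj (X : ModuleCat.{w} Q) : ModuleCat.{w} (Q ⧸ Ideal.span {r}) :=
  ModuleCat.of _ (QuotSMulTop r X)

/-- The quotient map `X → X / rX`. -/
def quotMk (X : ModuleCat.{w} Q) : X ⟶ (restrict r).obj (quotObj r X) :=
  ModuleCat.ofHom (X := X) (Y := (restrict r).obj (quotObj r X))
    { toFun := Submodule.Quotient.mk
      map_add' := fun _ _ => rfl
      map_smul' := fun _ _ => rfl }

/-- The map `X / rX → Y` induced by a map `X → Y` to a module killed by `r`. -/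
def quotDesc {X : ModuleCat.{w} Q} {Y : ModuleCat.{w} (Q ⧸ Ideal.span {r})}
    (g : X ⟶ (restrict r).obj Y) : (restrict r).obj (quotObj r X) ⟶ (restrict r).obj Y :=
  ModuleCat.ofHom (X := (restrict r).obj (quotObj r X)) (Y := (restrict r).obj Y)
    { toFun := Submodule.liftQ (r • (⊤ : Submodule Q X)) g.hom (by
        rintro _ ⟨x, -, rfl⟩
        exact (g.hom.map_smul r x).trans (smul_restrict_eq_zero r Y _))
      map_add' := map_add _
      map_smul' := fun q x => map_smul (Submodule.liftQ (r • (⊤ : Submodule Q X)) g.hom _) q x }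

theorem quotMk_quotDesc {X : ModuleCat.{w} Q} {Y : ModuleCat.{w} (Q ⧸ Ideal.span {r})}
    (g : X ⟶ (restrict r).obj Y) : quotMk r X ≫ quotDesc r g = g := rfl

theorem quotMk_surjective (X : ModuleCat.{w} Q) : Function.Surjective (quotMk r X).hom :=
  Submodule.Quotient.mk_surjective _

instance (X : ModuleCat.{w} Q) : Epi (quotMk r X) :=
  (ModuleCat.epi_iff_surjective _).2 (quotMk_surjective r X)

/-- The universal property of `X / rX`. -/
def quotEquiv (X : ModuleCat.{w} Q) (Y : ModuleCat.{w} (Q ⧸ Ideal.span {r})) :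
    (quotObj r X ⟶ Y) ≃ (X ⟶ (restrict r).obj Y) where
  toFun φ := quotMk r X ≫ (restrict r).map φ
  invFun g := (restrict r).preimage (quotDesc r g)
  left_inv φ := (restrict r).map_injective (by
    rw [Functor.map_preimage, ← cancel_epi (quotMk r X), quotMk_quotDesc])
  right_inv g := (congrArg (quotMk r X ≫ ·) ((restrict r).map_preimage _)).trans
    (quotMk_quotDesc r g)

/-- The adjunction between `X ↦ X / rX` and restriction of scalars. -/
def quotAdj : Adjunction.leftAdjointOfEquiv (quotEquiv.{u, w} r) (by intros; simp [quotEquiv]) ⊣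
    restrict.{u, w} r :=
  Adjunction.adjunctionOfEquivLeft _ _

theorem quotAdj_unit_app (X : ModuleCat.{w} Q) : (quotAdj r).unit.app X = quotMk r X := by
  simp [quotAdj, quotEquiv]

/-- A projective module embeds in a free one, where regularity is checked coordinatewise. -/
theorem isSMulRegular_of_projective {r : Q} (hr : r ∈ nonZeroDivisors Q) (X : Type*)
    [AddCommGroup X] [Module Q X] [Module.Projective Q X] : IsSMulRegular X r := by
  obtain ⟨s, hs⟩ := Module.Projective.out (R := Q) (P := X)
  intro x y hxy
  have hxy : r • x = r • y := hxy
  refine hs.injective (Finsupp.ext fun i => (mul_cancel_left_mem_nonZeroDivisors hr).1 ?_)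
  rw [← smul_eq_mul, ← smul_eq_mul, ← Finsupp.smul_apply, ← Finsupp.smul_apply, ← map_smul,
    ← map_smul, hxy]

theorem smul_id_apply (X : ModuleCat.{w} Q) (x : X) : (r • 𝟙 X : X ⟶ X).hom x = r • x := rfl

theorem shortExact_quot [Small.{w} Q] (hr : r ∈ nonZeroDivisors Q) (X : ModuleCat.{w} Q)
    (hX : Projective X) :
    ∃ w, (ShortComplex.mk (r • 𝟙 X) ((quotAdj r).unit.app X) w).ShortExact := by
  have hw : (r • 𝟙 X) ≫ quotMk r X = 0 := by
    ext x
    exact (Submodule.Quotient.mk_eq_zero _).2 (Submodule.smul_mem_pointwise_smul x r ⊤ trivial)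
  rw [quotAdj_unit_app]
  have : Module.Projective Q X := inferInstance
  have hreg : IsSMulRegular X r := isSMulRegular_of_projective hr X
  refine ⟨hw, ?_⟩
  have hm : Mono (r • 𝟙 X) := (ModuleCat.mono_iff_injective _).2 hreg
  refine { exact := ?_, mono_f := hm, epi_g := inferInstanceAs (Epi (quotMk r X)) }
  rw [ShortComplex.ShortExact.moduleCat_exact_iff_function_exact]
  intro x
  refine (Submodule.Quotient.mk_eq_zero (r • (⊤ : Submodule Q X))).trans ?_
  constructor
  · rintro ⟨y, -, rfl⟩
    exact ⟨y, rfl⟩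
  · rintro ⟨y, rfl⟩
    exact ⟨y, trivial, rfl⟩

/-- The submodule `{y ∈ Y | r y = 0}` as a `Q/(r)`-module. -/
abbrev torsionObj (Y : ModuleCat.{w} Q) : ModuleCat.{w} (Q ⧸ Ideal.span {r}) :=
  ModuleCat.of _ (Submodule.torsionBy Q Y r)

/-- The inclusion of the `r`-torsion. -/
def torsionι (Y : ModuleCat.{w} Q) : (restrict r).obj (torsionObj r Y) ⟶ Y :=
  ModuleCat.ofHom (X := (restrict r).obj (torsionObj r Y)) (Y := Y)
    { toFun := Subtype.val
      map_add' := fun _ _ => rfl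
      map_smul' := fun _ _ => rfl }

/-- The map to the `r`-torsion induced by a map from a module killed by `r`. -/
def torsionLift {X : ModuleCat.{w} (Q ⧸ Ideal.span {r})} {Y : ModuleCat.{w} Q}
    (g : (restrict r).obj X ⟶ Y) : (restrict r).obj X ⟶ (restrict r).obj (torsionObj r Y) :=
  ModuleCat.ofHom (X := (restrict r).obj X) (Y := (restrict r).obj (torsionObj r Y))
    { toFun := fun x => ⟨g.hom x, by
        rw [Submodule.mem_torsionBy_iff, ← map_smul, smul_restrict_eq_zero, map_zero]⟩
      map_add' := fun x y => Subtype.ext (g.hom.map_add x y)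
      map_smul' := fun q x => Subtype.ext (g.hom.map_smul q x) }

theorem torsionLift_torsionι {X : ModuleCat.{w} (Q ⧸ Ideal.span {r})} {Y : ModuleCat.{w} Q}
    (g : (restrict r).obj X ⟶ Y) : torsionLift r g ≫ torsionι r Y = g := rfl

instance (Y : ModuleCat.{w} Q) : Mono (torsionι r Y) :=
  (ModuleCat.mono_iff_injective _).2 Subtype.val_injective

/-- The universal property of the `r`-torsion. -/
def torsionEquiv (X : ModuleCat.{w} (Q ⧸ Ideal.span {r})) (Y : ModuleCat.{w} Q) :
    ((restrict r).obj X ⟶ Y) ≃ (X ⟶ torsionObj r Y) where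
  toFun g := (restrict r).preimage (torsionLift r g)
  invFun φ := (restrict r).map φ ≫ torsionι r Y
  left_inv g := (congrArg (· ≫ torsionι r Y) ((restrict r).map_preimage _)).trans
    (torsionLift_torsionι r g)
  right_inv φ := (restrict r).map_injective (by
    rw [Functor.map_preimage, ← cancel_mono (torsionι r Y), torsionLift_torsionι])

/-- The adjunction between restriction of scalars and `Y ↦ {y ∈ Y | r y = 0}`. -/
def torsionAdj : restrict.{u, w} r ⊣ Adjunction.rightAdjointOfEquiv (torsionEquiv.{u, w} r)
    (by
      intro X' X Y f g
      rw [← Equiv.eq_symm_apply]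
      simp [torsionEquiv, torsionLift_torsionι]) :=
  Adjunction.adjunctionOfEquivRight _ _

theorem torsionAdj_counit_app (Y : ModuleCat.{w} Q) :
    (torsionAdj r).counit.app Y = torsionι r Y := by
  simp [torsionAdj, torsionEquiv]

theorem shortExact_torsion [Small.{w} Q] (hr : r ∈ nonZeroDivisors Q) (X : ModuleCat.{w} Q)
    (hX : Injective X) :
    ∃ w, (ShortComplex.mk ((torsionAdj r).counit.app X) (r • 𝟙 X) w).ShortExact := by
  have hw : torsionι r X ≫ (r • 𝟙 X) = 0 := by
    ext x
    exact x.2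
  rw [torsionAdj_counit_app]
  have hinj : Module.Injective Q X := Module.injective_module_of_injective_object Q X
  have hdiv : Function.Surjective (r • 𝟙 X : X ⟶ X).hom := by
    intro x
    -- Extending `1 ↦ x` along the injection `r : Q → Q` gives `h` with `r • h 1 = x`, so injectives
    -- are `r`-divisible.
    obtain ⟨h, hh⟩ := Module.Injective.extension_property Q _ _ _ (LinearMap.lsmul Q Q r)
      (isSMulRegular_of_projective hr Q) (LinearMap.toSpanSingleton Q X x)
    refine ⟨h 1, ?_⟩
    have := LinearMap.congr_fun hh 1
    rw [smul_id_apply, ← map_smul]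
    simpa using this
  refine ⟨hw, ?_⟩
  have hm : Epi (r • 𝟙 X) := (ModuleCat.epi_iff_surjective _).2 hdiv
  refine { exact := ?_, epi_g := hm, mono_f := inferInstanceAs (Mono (torsionι r X)) }
  rw [ShortComplex.ShortExact.moduleCat_exact_iff_function_exact]
  intro x
  constructor
  · intro h
    exact ⟨⟨x, h⟩, rfl⟩
  · rintro ⟨y, rfl⟩
    exact y.2

end ChangeOfRings

/-! ### The four implications. -/

section MainTheorem

variable {Q : Type u} [CommRing Q] (f : Q)

/-- Restricting from `Q/(f)` to `Q` through `Q/(f^n)` is restricting directly. -/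
def toBaseIsoToPow (n : ℕ) (hn : n ≠ 0) (M : ModuleCat.{w} (Q ⧸ Ideal.span {f})) :
    toBase f M ≅ (restrict (f ^ n)).obj (toPow f n hn M) :=
  (ModuleCat.restrictScalarsComp'App (Ideal.Quotient.mk (Ideal.span {f ^ n}))
    (Ideal.Quotient.factor (span_pow_le f n hn)) (Ideal.Quotient.mk (Ideal.span {f}))
    (Ideal.Quotient.factor_comp_mk _).symm M)

theorem smul_id_toBase_eq_zero (M : ModuleCat.{w} (Q ⧸ Ideal.span {f})) :
    f • 𝟙 (toBase f M) = 0 := by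
  ext x
  exact smul_restrict_eq_zero f M x

variable [Small.{w} Q]

theorem qpd_toPow_lt_top (hf : f ∈ nonZeroDivisors Q) (M : ModuleCat.{w} (Q ⧸ Ideal.span {f}))
    (h : qpd (toBase f M) < ⊤) :
    ∃ N : ℕ, ∀ (n : ℕ) (hn : n ≠ 0), N ≤ n → qpd (toPow f n hn M) < ⊤ := by
  by_cases hM : IsZero (toBase f M)
  · exact ⟨0, fun n hn _ => qpd_lt_top_of_isZero
      (isZero_of_isZero_map (hM.of_iso (toBaseIsoToPow f n hn M).symm))⟩
  obtain ⟨P, hb, hP, hpow, hne⟩ := (qpd_lt_top_iff hM).1 h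
  obtain ⟨N, hN⟩ := exists_homotopy_pow_smul_zero_of_projective P hb hP f
    fun i => (hpow i).smul_id_eq_zero (smul_id_toBase_eq_zero f M)
  -- The bound `N` comes from `P` alone, so one complex over `Q` serves every `n ≥ N`.
  refine ⟨N, fun n hn hNn => ?_⟩
  exact qpd_lt_top_of_homotopy (quotAdj (f ^ n)) (f ^ n)
    (shortExact_quot (f ^ n) (pow_mem hf n))
    (fun h => hM (((restrict (f ^ n)).map_isZero h).of_iso (toBaseIsoToPow f n hn M))) P hb hP
    (fun i => (hpow i).of_iso_base (toBaseIsoToPow f n hn M)) hne (hN n hNn).some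

theorem qid_toPow_lt_top (hf : f ∈ nonZeroDivisors Q) (M : ModuleCat.{w} (Q ⧸ Ideal.span {f}))
    (h : qid (toBase f M) < ⊤) :
    ∃ N : ℕ, ∀ (n : ℕ) (hn : n ≠ 0), N ≤ n → qid (toPow f n hn M) < ⊤ := by
  by_cases hM : IsZero (toBase f M)
  · exact ⟨0, fun n hn _ => qid_lt_top_of_isZero
      (isZero_of_isZero_map (hM.of_iso (toBaseIsoToPow f n hn M).symm))⟩
  obtain ⟨P, hb, hP, hpow, hne⟩ := (qid_lt_top_iff hM).1 h
  obtain ⟨N, hN⟩ := exists_homotopy_pow_smul_zero_of_injective P hb hP f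
    fun i => (hpow i).smul_id_eq_zero (smul_id_toBase_eq_zero f M)
  refine ⟨N, fun n hn hNn => ?_⟩
  exact qid_lt_top_of_homotopy (torsionAdj (f ^ n)) (f ^ n)
    (shortExact_torsion (f ^ n) (pow_mem hf n))
    (fun h => hM (((restrict (f ^ n)).map_isZero h).of_iso (toBaseIsoToPow f n hn M))) P hb hP
    (fun i => (hpow i).of_iso_base (toBaseIsoToPow f n hn M)) hne (hN n hNn).some

theorem qpd_toBase_lt_top (hf : f ∈ nonZeroDivisors Q) (M : ModuleCat.{w} (Q ⧸ Ideal.span {f}))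
    (h : qpd M < ⊤) : qpd (toBase f M) < ⊤ :=
  qpd_map_lt_top (G := restrict f) (fun X _ =>
    hasProjectiveDimensionLT_two_map (quotAdj f) f (shortExact_quot f hf) X) h

theorem qid_toBase_lt_top (hf : f ∈ nonZeroDivisors Q) (M : ModuleCat.{w} (Q ⧸ Ideal.span {f}))
    (h : qid M < ⊤) : qid (toBase f M) < ⊤ :=
  qid_map_lt_top (G := restrict f) (fun X _ =>
    hasInjectiveDimensionLT_two_map (torsionAdj f) f (shortExact_torsion f hf) X) h

end MainTheorem

end

end QuasiDim

theorem proposition2p8 {Q : Type u} [CommRing Q] [IsNoetherianRing Q] [Small.{w} Q]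
    (f : Q) (hf : f ∈ nonZeroDivisors Q) (M : ModuleCat.{w} (Q ⧸ Ideal.span {f})) :
    ((QuasiDim.qpd (QuasiDim.toBase f M) < ⊤ →
        ∃ N : ℕ, ∀ (n : ℕ) (hn : n ≠ 0), N ≤ n → QuasiDim.qpd (QuasiDim.toPow f n hn M) < ⊤) ∧
      (QuasiDim.qpd M < ⊤ → QuasiDim.qpd (QuasiDim.toBase f M) < ⊤)) ∧
    ((QuasiDim.qid (QuasiDim.toBase f M) < ⊤ →
        ∃ N : ℕ, ∀ (n : ℕ) (hn : n ≠ 0), N ≤ n → QuasiDim.qid (QuasiDim.toPow f n hn M) < ⊤) ∧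
      (QuasiDim.qid M < ⊤ → QuasiDim.qid (QuasiDim.toBase f M) < ⊤)) :=
  ⟨⟨QuasiDim.qpd_toPow_lt_top f hf M, QuasiDim.qpd_toBase_lt_top f hf M⟩,
    ⟨QuasiDim.qid_toPow_lt_top f hf M, QuasiDim.qid_toBase_lt_top f hf M⟩⟩
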